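/- **Theorem.** Fix real numbers $\theta_1,\sigma_*,c_\mu,C_M>0$. There exist finite constants $C$ and $N_0$, depending only on $\theta_1,\sigma_*,c_\mu,C_M$, for which the following holds. For each integer $N\ge1$ let $\{X^N_i\}_{i\ge1}$ be a sequence of i.i.d. real random variables (the probability space may depend on $N$), and write $M_N(\theta)=\mathbb E[e^{\theta X^N_1}]$, $\mu_N=\mathbb E[X^N_1]$ and $S^N_m=\sum_{k=1}^m X^N_k$. Assume that: 1. there is $\theta_0>\theta_1$ such that $M_N(\theta)<\infty$ for all $N\ge1$ and $\theta\in(-\theta_0,\theta_0)$, and $|M_N^{(i)}(\theta)|\le C_M$ for all $N\ge1$, $0\le i\le3$ and $\theta\in[-\theta_1,\theta_1]$, where $M_N^{(i)}$ is the $i$-th derivative of $M_N$; 2. $\operatorname{Var}(X^N_1)\ge\sigma_*^2$ for all $N\ge1$; 3. $\mu_N\le0$ for all $N\ge1$, and $\mu_N\ge-c_\mu(\log N)^{-3}$ for all $N\ge2$. Then for every $N\ge N_0$ and every real $x\ge(\log N)^2$, $$\mathbb P\Big(\max_{1\le m\le N}S^N_m\le x\Big)\le C\,x\,(\log N)\,\big(|\mu_N|\vee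 N^{-1/2}\big).$$ -/

import Mathlib

open MeasureTheory ProbabilityTheory

noncomputable section

/-- The random walk `S_m = X_1 + ⋯ + X_m`. Steps are indexed from zero: `X k` is the
`(k + 1)`-st step. -/
def walk {Ω : Type*} (X : ℕ → Ω → ℝ) (m : ℕ) (ω : Ω) : ℝ :=
  ∑ k ∈ Finset.range m, X k ω

/-- The running maximum `max_{1 ≤ m ≤ N} S_m` of the walk, for `N ≥ 1`. -/
def runningMax {Ω : Type*} (X : ℕ → Ω → ℝ) (N : ℕ) (ω : Ω) : ℝ :=
  ⨆ m : Set.Icc 1 N, walk X (m : ℕ) ω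

/-- For `N ≥ 1`, the running maximum is attained and is an upper bound, so it is the genuine
maximum of the finitely many values. -/
theorem runningMax_isGreatest {Ω : Type*} (X : ℕ → Ω → ℝ) {N : ℕ} (hN : 1 ≤ N) (ω : Ω) :
    IsGreatest ((fun m => walk X m ω) '' Set.Icc 1 N) (runningMax X N ω) := by
  have : Nonempty (Set.Icc 1 N) := ⟨⟨1, le_refl 1, hN⟩⟩
  constructor
  · obtain ⟨i, hi⟩ := exists_eq_ciSup_of_finite (f := fun m : Set.Icc 1 N => walk X (m : ℕ) ω)
    exact ⟨i, i.2, hi⟩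
  · rintro _ ⟨m, hm, rfl⟩
    exact le_ciSup (f := fun m : Set.Icc 1 N => walk X (m : ℕ) ω)
      (Set.finite_range _).bddAbove ⟨m, hm⟩

/-- A sequence of i.i.d. real random variables under `P`. -/
structure IsIIDSteps {Ω : Type*} [MeasurableSpace Ω] (P : Measure Ω) (X : ℕ → Ω → ℝ) : Prop where
  measurable : ∀ k, Measurable (X k)
  indep : iIndepFun X P
  identDistrib : ∀ k, IdentDistrib (X k) (X 0) P P

/-- The assumptions on the array of steps `X N k` (row `N ≥ 1`, with its own probability measure
`P N`): each row is i.i.d.; the moment generating functions are finite on a common open interval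
that contains `[-θ₁, θ₁]`, on which they and their first three derivatives are bounded by `CM`;
the variances are at least `σ ^ 2`; and the means `μ_N` lie in `[-cμ (log N)⁻³, 0]`.
(For `N = 1` the lower bound `-cμ (log N)⁻³` reads `-∞`, so it is required only for `N ≥ 2`.) -/
structure SmallDriftArray (θ₁ σ cμ CM : ℝ) {Ω : ℕ → Type*} [∀ N, MeasurableSpace (Ω N)]
    (P : ∀ N, Measure (Ω N)) (X : ∀ N, ℕ → Ω N → ℝ) : Prop where
  iid : ∀ N, 1 ≤ N → IsIIDSteps (P N) (X N)
  mgf_finite : ∃ θ₀ : ℝ, θ₁ < θ₀ ∧ ∀ N, 1 ≤ N → ∀ θ ∈ Set.Ioo (-θ₀) θ₀,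
    Integrable (fun ω => Real.exp (θ * X N 0 ω)) (P N)
  mgf_bound : ∀ N, 1 ≤ N → ∀ i ≤ 3, ∀ θ ∈ Set.Icc (-θ₁) θ₁,
    |iteratedDeriv i (mgf (X N 0) (P N)) θ| ≤ CM
  variance_ge : ∀ N, 1 ≤ N → σ ^ 2 ≤ variance (X N 0) (P N)
  mean_nonpos : ∀ N, 1 ≤ N → ∫ ω, X N 0 ω ∂(P N) ≤ 0
  mean_ge : ∀ N : ℕ, 2 ≤ N → -cμ * (Real.log (N : ℝ)) ^ (-3 : ℤ) ≤ ∫ ω, X N 0 ω ∂(P N)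

end

/-! Write M(s) for the moment generating function. Since exp(s S_k) / M(s)^k is a martingale, stop
it at the first passage above x. If p is the probability of no passage up to N, this gives 1 ≤
exp(sx) (exp(sL) (1 - p) + error) + exp(sx) M(s)^(-N) p, where the error pays for overshoots beyond
L (`measureReal_staysBelow_mul_le`). Let δ be the larger of |μ_N| and N^(-1/2), and take s of order
δ. A cubic expansion gives M(s) ≥ 1 + σ² s² / 4 (`one_add_le_mgf`), so M(s)^N is bounded away from
1. With L = x, the rest is O(sx) plus an overshoot error O(N^(-1/2)), small because x ≥ (log N)².
Hence p = O(xδ). -/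

/-! ### Elementary inequalities for the exponential. -/

/-- The third Taylor polynomial of the exponential at `0` is a global lower bound. -/
theorem cubic_le_exp (y : ℝ) : 1 + y + y ^ 2 / 2 + y ^ 3 / 6 ≤ Real.exp y := by
  rcases le_total 0 y with hy | hy
  · have h := Real.sum_le_exp_of_nonneg hy 4
    norm_num [Finset.sum_range_succ, Nat.factorial] at h
    linarith
  -- The polynomial times exp(-y) has derivative -y³/6 · exp(-y), nonnegative for y ≤ 0, and equals
  -- 1 at 0.
  · set h : ℝ → ℝ := fun y => (1 + y + y ^ 2 / 2 + y ^ 3 / 6) * Real.exp (-y) with hh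
    have hd : ∀ z, HasDerivAt h (-z ^ 3 / 6 * Real.exp (-z)) z := by
      intro z
      have h1 : HasDerivAt (fun y : ℝ => 1 + y + y ^ 2 / 2 + y ^ 3 / 6) (1 + z + z ^ 2 / 2) z := by
        have := (((hasDerivAt_id z).const_add 1).add ((hasDerivAt_pow 2 z).div_const 2)).add
          ((hasDerivAt_pow 3 z).div_const 6)
        refine this.congr_deriv ?_
        norm_num
        ring
      refine (h1.mul (hasDerivAt_neg z).exp).congr_deriv ?_
      ring
    have hmono : MonotoneOn h (Set.Iic 0) := by
      refine monotoneOn_of_deriv_nonneg (convex_Iic 0)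
        (fun z _ => (hd z).continuousAt.continuousWithinAt)
        (fun z _ => (hd z).differentiableAt.differentiableWithinAt) fun z hz => ?_
      rw [interior_Iic] at hz
      rw [(hd z).deriv]
      have : 0 ≤ -z ^ 3 := by
        rw [show -z ^ 3 = (-z) ^ 3 by ring]
        exact pow_nonneg (neg_nonneg.2 (le_of_lt hz)) 3
      positivity
    have h0 := hmono (Set.mem_Iic.2 hy) (Set.mem_Iic.2 le_rfl) hy
    simp only [hh, Real.exp_neg] at h0
    rw [← div_eq_mul_inv, div_le_iff₀ (Real.exp_pos y)] at h0
    simpa using h0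

/-- Truncation of the overshoot: beyond L, exp(sy) = exp(-(t - s)y) exp(ty), and the first factor is
at most its value at L. -/
theorem exp_mul_le_of_le {s t L y : ℝ} (hs : 0 ≤ s) (hst : s ≤ t) :
    Real.exp (s * y) ≤ Real.exp (s * L) + Real.exp (-(t - s) * L) * Real.exp (t * y) := by
  rw [← Real.exp_add]
  rcases le_total y L with h | h
  · exact (Real.exp_le_exp.2 (mul_le_mul_of_nonneg_left h hs)).trans
      (le_add_of_nonneg_right (Real.exp_pos _).le)
  · refine le_trans (Real.exp_le_exp.2 ?_) (le_add_of_nonneg_left (Real.exp_pos _).le)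
    nlinarith [mul_nonneg (sub_nonneg.2 hst) (sub_nonneg.2 h)]

/-! ### Stopping the exponential martingale at first passage. -/

section Walk

variable {Ω : Type*}

theorem walk_succ (X : ℕ → Ω → ℝ) (k : ℕ) (ω : Ω) :
    walk X (k + 1) ω = walk X k ω + X k ω :=
  Finset.sum_range_succ _ _

/-- The event that the walk, started at `0`, does not exceed `x` up to time `k`. -/
def staysBelow (X : ℕ → Ω → ℝ) (x : ℝ) (k : ℕ) : Set Ω :=
  {ω | ∀ m ≤ k, walk X m ω ≤ x}

theorem staysBelow_succ_subset (X : ℕ → Ω → ℝ) (x : ℝ) (k : ℕ) :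
    staysBelow X x (k + 1) ⊆ staysBelow X x k :=
  fun _ h m hm => h m (hm.trans k.le_succ)

theorem setOf_runningMax_le_subset (X : ℕ → Ω → ℝ) {x : ℝ} (hx : 0 ≤ x) {N : ℕ} (hN : 1 ≤ N) :
    {ω | runningMax X N ω ≤ x} ⊆ staysBelow X x N := by
  intro ω hω m hm
  rcases Nat.eq_zero_or_pos m with rfl | h
  -- `staysBelow` includes time 0, the maximum does not; hence 0 ≤ x is needed.
  · simpa [walk] using hx
  · exact ((runningMax_isGreatest X hN ω).2 ⟨m, ⟨h, hm⟩, rfl⟩).trans hω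

/-- The information carried by the first `k` steps. -/
abbrev history (X : ℕ → Ω → ℝ) (k : ℕ) : MeasurableSpace Ω :=
  ⨆ i ∈ {i | i < k}, MeasurableSpace.comap (X i) inferInstance

theorem measurable_walk_history (X : ℕ → Ω → ℝ) {m k : ℕ} (hm : m ≤ k) :
    Measurable[history X k] (walk X m) := by
  refine Finset.measurable_fun_sum _ fun i hi => ?_
  refine Measurable.mono (comap_measurable (X i)) ?_ le_rfl
  exact le_iSup₂_of_le i (show i < k from (Finset.mem_range.1 hi).trans_le hm) le_rfl

theorem measurableSet_staysBelow_history (X : ℕ → Ω → ℝ) (x : ℝ) (k : ℕ) :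
    MeasurableSet[history X k] (staysBelow X x k) := by
  have : staysBelow X x k = ⋂ m, ⋂ (_ : m ≤ k), walk X m ⁻¹' Set.Iic x := by
    ext ω
    simp [staysBelow]
  rw [this]
  exact MeasurableSet.iInter fun m => MeasurableSet.iInter fun hm =>
    measurable_walk_history X hm measurableSet_Iic

namespace IsIIDSteps

variable [MeasurableSpace Ω] {P : Measure Ω} {X : ℕ → Ω → ℝ}

theorem history_le (h : IsIIDSteps P X) (k : ℕ) : history X k ≤ ‹MeasurableSpace Ω› :=
  iSup₂_le fun i _ => (h.measurable i).comap_le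

theorem measurable_walk (h : IsIIDSteps P X) (k : ℕ) : Measurable (walk X k) :=
  (measurable_walk_history X le_rfl).mono (h.history_le k) le_rfl

theorem measurableSet_staysBelow (h : IsIIDSteps P X) (x : ℝ) (k : ℕ) :
    MeasurableSet (staysBelow X x k) :=
  h.history_le k _ (measurableSet_staysBelow_history X x k)

theorem integrable_exp_mul (h : IsIIDSteps P X) {t : ℝ}
    (ht : Integrable (fun ω => Real.exp (t * X 0 ω)) P) (k : ℕ) :
    Integrable (fun ω => Real.exp (t * X k ω)) P :=
  ((h.identDistrib k).comp (u := fun y => Real.exp (t * y)) (by fun_prop)).integrable_iff.2 ht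

theorem integral_exp_mul (h : IsIIDSteps P X) (t : ℝ) (k : ℕ) :
    ∫ ω, Real.exp (t * X k ω) ∂P = mgf (X 0) P t :=
  ((h.identDistrib k).comp (u := fun y => Real.exp (t * y)) (by fun_prop)).integral_eq

theorem integrable_exp_mul_walk [IsProbabilityMeasure P] (h : IsIIDSteps P X) {t : ℝ}
    (ht : Integrable (fun ω => Real.exp (t * X 0 ω)) P) (k : ℕ) :
    Integrable (fun ω => Real.exp (t * walk X k ω)) P := by
  have := h.indep.integrable_exp_mul_sum h.measurable (s := Finset.range k)
    (fun i _ => h.integrable_exp_mul ht i)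
  simpa [walk] using this

/-- The exponential of the walk gains a factor `mgf` per step, also on the event that the walk has
not exceeded `x` so far. -/
theorem setIntegral_exp_mul_walk_succ (h : IsIIDSteps P X) (t x : ℝ) (k : ℕ) :
    ∫ ω in staysBelow X x k, Real.exp (t * walk X (k + 1) ω) ∂P =
      mgf (X 0) P t * ∫ ω in staysBelow X x k, Real.exp (t * walk X k ω) ∂P := by
  have hE := h.measurableSet_staysBelow x k
  set f : Ω → ℝ := (staysBelow X x k).indicator fun ω => Real.exp (t * walk X k ω) with hf
  have hfm : Measurable[history X k] f :=
    (Real.measurable_exp.comp ((measurable_walk_history X le_rfl).const_mul t)).indicator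
      (measurableSet_staysBelow_history X x k)
  have hindep : IndepFun f (fun ω => Real.exp (t * X k ω)) P := by
    have hI : Indep (history X k) (⨆ i ∈ ({k} : Set ℕ), MeasurableSpace.comap (X i) inferInstance)
        P := indep_iSup_of_disjoint (fun i => (h.measurable i).comap_le) h.indep (by simp)
    rw [iSup_singleton] at hI
    refine indep_of_indep_of_le_left (indep_of_indep_of_le_right hI ?_) hfm.comap_le
    exact Measurable.comap_le
      ((by fun_prop : Measurable fun y : ℝ => Real.exp (t * y)).comp (comap_measurable (X k)))
  have hXm := h.measurable k
  have key := hindep.integral_fun_mul_eq_mul_integral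
    (hfm.mono (h.history_le k) le_rfl).aestronglyMeasurable
    (by fun_prop : Measurable fun ω => Real.exp (t * X k ω)).aestronglyMeasurable
  rw [h.integral_exp_mul, hf, integral_indicator hE, mul_comm] at key
  rw [← key, ← integral_indicator hE]
  refine integral_congr_ae (Filter.Eventually.of_forall fun ω => ?_)
  by_cases hω : ω ∈ staysBelow X x k
  · simp [hω, walk_succ, mul_add, Real.exp_add]
  · simp [hω]

/-- The contribution of the first passage above `x` at step `k + 1`. -/
theorem setIntegral_exp_mul_walk_diff_le [IsProbabilityMeasure P] (h : IsIIDSteps P X)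
    {s t : ℝ} (hs : 0 ≤ s) (hst : s ≤ t)
    (his : Integrable (fun ω => Real.exp (s * X 0 ω)) P)
    (hit : Integrable (fun ω => Real.exp (t * X 0 ω)) P) (x L : ℝ) (k : ℕ) :
    ∫ ω in staysBelow X x k \ staysBelow X x (k + 1), Real.exp (s * walk X (k + 1) ω) ∂P ≤
      Real.exp (s * x) * (Real.exp (s * L) *
        (P.real (staysBelow X x k) - P.real (staysBelow X x (k + 1))) +
        Real.exp (-(t - s) * L) * mgf (X 0) P t) := by
  have hE := h.measurableSet_staysBelow x k
  have hE' := h.measurableSet_staysBelow x (k + 1)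
  set D := staysBelow X x k \ staysBelow X x (k + 1) with hD
  have hitk := h.integrable_exp_mul hit k
  have hPD : P.real D = P.real (staysBelow X x k) - P.real (staysBelow X x (k + 1)) :=
    measureReal_sdiff (staysBelow_succ_subset X x k) hE'
  calc ∫ ω in D, Real.exp (s * walk X (k + 1) ω) ∂P
      ≤ ∫ ω in D, Real.exp (s * x) *
          (Real.exp (s * L) + Real.exp (-(t - s) * L) * Real.exp (t * X k ω)) ∂P := by
        refine setIntegral_mono_on (h.integrable_exp_mul_walk his _).integrableOn
          (((integrable_const _).add (hitk.const_mul _)).const_mul _).integrableOn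
          (hE.diff hE') fun ω hω => ?_
        -- The walk is still at most x at time k, so the overshoot is at most the last step.
        rw [walk_succ, mul_add, Real.exp_add]
        gcongr
        · exact hω.1 k le_rfl
        · exact exp_mul_le_of_le hs hst
    _ = Real.exp (s * x) * (Real.exp (s * L) * P.real D +
          Real.exp (-(t - s) * L) * ∫ ω in D, Real.exp (t * X k ω) ∂P) := by
        rw [integral_const_mul, integral_add (integrable_const _) (hitk.const_mul _).integrableOn,
          integral_const_mul, setIntegral_const, smul_eq_mul, mul_comm (P.real D)]
    _ ≤ _ := by
        rw [hPD, ← h.integral_exp_mul t k]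
        have hle : ∫ ω in D, Real.exp (t * X k ω) ∂P ≤ ∫ ω, Real.exp (t * X k ω) ∂P :=
          setIntegral_le_integral hitk (Filter.Eventually.of_forall fun ω => (Real.exp_pos _).le)
        exact mul_le_mul_of_nonneg_left (add_le_add le_rfl
          (mul_le_mul_of_nonneg_left hle (Real.exp_pos _).le)) (Real.exp_pos _).le

/-- Optional stopping by induction: each step multiplies the integral by M(s) and removes the
first-passage part, and the exit probabilities telescope. -/
theorem le_setIntegral_exp_mul_walk [IsProbabilityMeasure P] (h : IsIIDSteps P X)
    {s t : ℝ} (hs : 0 ≤ s) (hst : s ≤ t)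
    (his : Integrable (fun ω => Real.exp (s * X 0 ω)) P)
    (hit : Integrable (fun ω => Real.exp (t * X 0 ω)) P) {x : ℝ} (hx : 0 ≤ x) (L : ℝ)
    (hM : 1 ≤ mgf (X 0) P s) (k : ℕ) :
    mgf (X 0) P s ^ k * (1 - Real.exp (s * x) * (Real.exp (s * L) *
        (1 - P.real (staysBelow X x k)) + k * (Real.exp (-(t - s) * L) * mgf (X 0) P t))) ≤
      ∫ ω in staysBelow X x k, Real.exp (s * walk X k ω) ∂P := by
  induction k with
  | zero =>
    have : staysBelow X x 0 = Set.univ := by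
      ext ω
      simpa [staysBelow, walk] using hx
    simp [this, walk]
  | succ k ih =>
    have hsub := staysBelow_succ_subset X x k
    have hint := h.integrable_exp_mul_walk his (k + 1)
    have hsplit := setIntegral_sdiff (h.measurableSet_staysBelow x (k + 1)) hint.integrableOn hsub
    have hdiff := h.setIntegral_exp_mul_walk_diff_le hs hst his hit x L k
    rw [hsplit, h.setIntegral_exp_mul_walk_succ] at hdiff
    set M := mgf (X 0) P s
    set J := Real.exp (s * x) * (Real.exp (s * L) *
        (P.real (staysBelow X x k) - P.real (staysBelow X x (k + 1))) +
        Real.exp (-(t - s) * L) * mgf (X 0) P t) with hJ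
    have hJ0 : 0 ≤ J := by
      have := sub_nonneg.2 (measureReal_mono hsub (μ := P))
      have := mgf_nonneg (X := X 0) (μ := P) (t := t)
      positivity
    have h1 := mul_le_mul_of_nonneg_left ih (zero_le_one.trans hM)
    -- Discounting of later exits is discarded, so that the losses add up.
    have h2 : J ≤ M ^ (k + 1) * J := le_mul_of_one_le_left hJ0 (one_le_pow₀ hM)
    have h3 : M * (M ^ k * (1 - Real.exp (s * x) * (Real.exp (s * L) *
        (1 - P.real (staysBelow X x k)) + k * (Real.exp (-(t - s) * L) * mgf (X 0) P t)))) -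
        M ^ (k + 1) * J = M ^ (k + 1) * (1 - Real.exp (s * x) * (Real.exp (s * L) *
        (1 - P.real (staysBelow X x (k + 1))) +
        ((k + 1 : ℕ) : ℝ) * (Real.exp (-(t - s) * L) * mgf (X 0) P t))) := by
      rw [hJ]
      push_cast
      ring
    linarith

/-- If the moment generating function exceeds `1` at `s ≥ 0`, then the walk is unlikely to stay
below `x`. The parameter `L` is a truncation level for the overshoot. -/
theorem measureReal_staysBelow_mul_le [IsProbabilityMeasure P] (h : IsIIDSteps P X)
    {s t : ℝ} (hs : 0 ≤ s) (hst : s ≤ t)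
    (his : Integrable (fun ω => Real.exp (s * X 0 ω)) P)
    (hit : Integrable (fun ω => Real.exp (t * X 0 ω)) P) {x L : ℝ} (hx : 0 ≤ x) (hL : 0 ≤ L)
    (hM : 1 ≤ mgf (X 0) P s) (k : ℕ) :
    P.real (staysBelow X x k) * (1 - (mgf (X 0) P s ^ k)⁻¹) ≤
      Real.exp (s * L) - Real.exp (-(s * x)) +
        k * (Real.exp (-(t - s) * L) * mgf (X 0) P t) := by
  have hlow := h.le_setIntegral_exp_mul_walk hs hst his hit hx L hM k
  have hup : ∫ ω in staysBelow X x k, Real.exp (s * walk X k ω) ∂P ≤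
      Real.exp (s * x) * P.real (staysBelow X x k) := by
    calc _ ≤ ∫ _ω in staysBelow X x k, Real.exp (s * x) ∂P := by
          refine setIntegral_mono_on (h.integrable_exp_mul_walk his _).integrableOn
            (integrable_const _).integrableOn (h.measurableSet_staysBelow x k) fun ω hω => ?_
          gcongr
          exact hω k le_rfl
      _ = _ := by rw [setIntegral_const, smul_eq_mul, mul_comm]
  have h1 := hlow.trans hup
  set Q := mgf (X 0) P s ^ k
  have hQ : 0 < Q := pow_pos (zero_lt_one.trans_le hM) k
  set p := P.real (staysBelow X x k)
  set η := Real.exp (-(t - s) * L) * mgf (X 0) P t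
  have hex := Real.exp_pos (s * x)
  have h2 : 1 - Real.exp (s * x) * (Real.exp (s * L) * (1 - p) + k * η) ≤
      Real.exp (s * x) * (Q⁻¹ * p) := by
    refine le_of_mul_le_mul_left (h1.trans_eq ?_) hQ
    field_simp
  have h3 : Real.exp (-(s * x)) - (Real.exp (s * L) * (1 - p) + k * η) ≤ Q⁻¹ * p := by
    refine le_of_mul_le_mul_left (le_trans (le_of_eq ?_) h2) hex
    rw [mul_sub, ← Real.exp_add, add_neg_cancel, Real.exp_zero]
  have h4 : 1 ≤ Real.exp (s * L) := Real.one_le_exp (mul_nonneg hs hL)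
  have h5 : p ≤ p * Real.exp (s * L) := le_mul_of_one_le_right measureReal_nonneg h4
  linarith

end IsIIDSteps

end Walk

/-! ### Estimates for the exponential growth and the errors. -/

/-- A cubic lower bound for the moment generating function. -/
theorem cubic_le_mgf {Ω : Type*} [MeasurableSpace Ω] {P : Measure Ω} [IsProbabilityMeasure P]
    {Y : Ω → ℝ} (h0 : 0 ∈ interior (integrableExpSet Y P)) {t : ℝ}
    (ht : Integrable (fun ω => Real.exp (t * Y ω)) P) :
    1 + t * (∫ ω, Y ω ∂P) + t ^ 2 / 2 * (∫ ω, Y ω ^ 2 ∂P) +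
      t ^ 3 / 6 * iteratedDeriv 3 (mgf Y P) 0 ≤ mgf Y P t := by
  have hpow := integrable_pow_of_mem_interior_integrableExpSet h0
  have h1 : Integrable (fun ω => t * Y ω) P := by simpa using (hpow 1).const_mul t
  have h2 := (hpow 2).const_mul (t ^ 2 / 2)
  have h3 := (hpow 3).const_mul (t ^ 3 / 6)
  have hc : Integrable (fun _ : Ω => (1 : ℝ)) P := integrable_const 1
  have h01 := hc.add h1
  have h012 := h01.add h2
  have h0123 := h012.add h3
  have hmono := integral_mono h0123 ht fun ω => by
    have := cubic_le_exp (t * Y ω)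
    simp only [Pi.add_apply]
    linarith [mul_pow t (Y ω) 2, mul_pow t (Y ω) 3]
  rw [integral_add' h012 h3, integral_add' h01 h2, integral_add' hc h1] at hmono
  simp only [integral_const_mul, integral_const, probReal_univ, smul_eq_mul, mul_one] at hmono
  rw [iteratedDeriv_mgf_zero h0]
  exact hmono

theorem exp_sub_exp_neg_le {y : ℝ} (hy0 : 0 ≤ y) (hy1 : y ≤ 1) :
    Real.exp y - Real.exp (-y) ≤ 3 * y := by
  have h1 := (abs_le.1 (Real.abs_exp_sub_one_sub_id_le (x := y) (by rwa [abs_of_nonneg hy0]))).2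
  have h2 := Real.add_one_le_exp (-y)
  nlinarith

/-- The exponent is at most log N - c (log N)² ≤ -(log N) / 2. -/
theorem nat_mul_exp_neg_le_rpow {c x : ℝ} {N : ℕ} (hN : 1 ≤ N) (hx : Real.log N ^ 2 ≤ x)
    (hc : 0 ≤ c) (hcN : 3 / 2 ≤ c * Real.log N) :
    N * Real.exp (-(c * x)) ≤ (N : ℝ) ^ (-(1 / 2) : ℝ) := by
  have hN0 : (0 : ℝ) < N := by exact_mod_cast hN
  have hlog : 0 ≤ Real.log N := Real.log_nonneg (by exact_mod_cast hN)
  rw [Real.rpow_def_of_pos hN0]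
  nth_rewrite 1 [← Real.exp_log hN0]
  rw [← Real.exp_add]
  apply Real.exp_le_exp.2
  nlinarith [mul_le_mul_of_nonneg_left hx hc, mul_le_mul_of_nonneg_right hcN hlog]

/-- A positive drift `σ ^ 2 / 4 * t ^ 2` of the exponential with `t` at least of order `N ^ (-1/2)`
accumulates to a gain bounded away from `1` in `N` steps. -/
theorem le_one_sub_inv_pow {σ t M : ℝ} {N : ℕ} (hσ : 0 < σ) (hM : 1 + σ ^ 2 / 4 * t ^ 2 ≤ M)
    (ht : 64 ≤ N * (σ ^ 2 * t) ^ 2) : 16 / (σ ^ 2 + 16) ≤ 1 - (M ^ N)⁻¹ := by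
  have hM0 : 0 ≤ M - 1 := by nlinarith [sq_nonneg (σ * t)]
  have h1 := one_add_mul_le_pow (a := M - 1) (by linarith) N
  rw [add_sub_cancel] at h1
  have h2 : 16 / σ ^ 2 ≤ N * (M - 1) := by
    rw [div_le_iff₀ (by positivity)]
    have h3 : N * (σ ^ 2 / 4 * t ^ 2) ≤ N * (M - 1) := by
      gcongr
      linarith
    nlinarith [mul_le_mul_of_nonneg_right h3 (sq_nonneg σ)]
  have h4 : (σ ^ 2 + 16) / σ ^ 2 ≤ M ^ N := by
    rw [add_div, div_self (by positivity)]
    linarith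
  have h5 := inv_anti₀ (by positivity) h4
  rw [inv_div] at h5
  have h6 : 16 / (σ ^ 2 + 16) = 1 - σ ^ 2 / (σ ^ 2 + 16) := by field_simp; ring
  linarith

/-! ### One row of the array. -/

namespace SmallDriftArray

variable {θ₁ σ cμ CM : ℝ} {Ω : ℕ → Type*} [∀ N, MeasurableSpace (Ω N)]
  {P : ∀ N, Measure (Ω N)} {X : ∀ N, ℕ → Ω N → ℝ}

theorem integrable_exp_mul (h : SmallDriftArray θ₁ σ cμ CM P X) {N : ℕ} (hN : 1 ≤ N) {t : ℝ}
    (ht : t ∈ Set.Icc (-θ₁) θ₁) : Integrable (fun ω => Real.exp (t * X N 0 ω)) (P N) := by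
  obtain ⟨θ₀, h0, hint⟩ := h.mgf_finite
  exact hint N hN t ⟨by linarith [ht.1], by linarith [ht.2]⟩

theorem mgf_le (h : SmallDriftArray θ₁ σ cμ CM P X) {N : ℕ} (hN : 1 ≤ N) {t : ℝ}
    (ht : t ∈ Set.Icc (-θ₁) θ₁) : mgf (X N 0) (P N) t ≤ CM := by
  simpa using (le_abs_self _).trans (h.mgf_bound N hN 0 (by norm_num) t ht)

/-- Once `t` dominates a multiple of the drift, the moment generating function at `t` exceeds `1`
by an amount of order `t ^ 2`. -/
theorem one_add_le_mgf [∀ N, IsProbabilityMeasure (P N)] (h : SmallDriftArray θ₁ σ cμ CM P X)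
    {N : ℕ} (hN : 1 ≤ N) {t : ℝ} (ht0 : 0 ≤ t) (ht1 : t ≤ θ₁) (hθ₁ : 0 < θ₁)
    (hμ : 8 * |∫ ω, X N 0 ω ∂(P N)| ≤ σ ^ 2 * t) (htC : 4 * CM * t ≤ 3 * σ ^ 2) :
    1 + σ ^ 2 / 4 * t ^ 2 ≤ mgf (X N 0) (P N) t := by
  have h0 : (0 : ℝ) ∈ interior (integrableExpSet (X N 0) (P N)) := by
    rw [mem_interior_iff_mem_nhds]
    exact Filter.mem_of_superset (Icc_mem_nhds (neg_neg_of_pos hθ₁) hθ₁)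
      fun s hs => h.integrable_exp_mul hN hs
  have hcub := cubic_le_mgf h0 (h.integrable_exp_mul hN (t := t) ⟨by linarith, ht1⟩)
  have hvar : σ ^ 2 ≤ ∫ ω, X N 0 ω ^ 2 ∂(P N) :=
    (h.variance_ge N hN).trans
      (variance_le_expectation_sq ((h.iid N hN).measurable 0).aestronglyMeasurable)
  have h3 := (abs_le.1 (h.mgf_bound N hN 3 le_rfl 0 ⟨by linarith, hθ₁.le⟩)).1
  have hμ' := neg_abs_le (∫ ω, X N 0 ω ∂(P N))
  -- Of the quadratic gain σ² t² / 2, the drift and the cubic term each consume at most σ² t² / 8.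
  have e1 : t * (-(σ ^ 2 * t / 8)) ≤ t * ∫ ω, X N 0 ω ∂(P N) :=
    mul_le_mul_of_nonneg_left (by linarith) ht0
  have e2 := mul_le_mul_of_nonneg_left hvar (by positivity : 0 ≤ t ^ 2 / 2)
  have e3 := mul_le_mul_of_nonneg_left h3 (by positivity : 0 ≤ t ^ 3 / 6)
  have e4 := mul_le_mul_of_nonneg_left htC (by positivity : 0 ≤ t ^ 2 / 24)
  nlinarith

/-- The bound for one row, in terms of an exponent `s` that dominates both the drift and the
diffusive scale. -/
theorem measureReal_staysBelow_mul_le [∀ N, IsProbabilityMeasure (P N)]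
    (h : SmallDriftArray θ₁ σ cμ CM P X) (hθ₁ : 0 < θ₁) (hσ : 0 < σ) (hCM : 0 ≤ CM)
    {N : ℕ} (hN : 1 ≤ N) {s x : ℝ} (hs0 : 0 ≤ s) (hsθ : s ≤ θ₁ / 2)
    (hμ : 8 * |∫ ω, X N 0 ω ∂(P N)| ≤ σ ^ 2 * s) (hsC : 4 * CM * s ≤ 3 * σ ^ 2)
    (hsN : 64 ≤ N * (σ ^ 2 * s) ^ 2) (hlog : 3 / θ₁ ≤ Real.log N) (hx : Real.log N ^ 2 ≤ x)
    (hsx : s * x ≤ 1) :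
    (P N).real (staysBelow (X N) x N) * (16 / (σ ^ 2 + 16)) ≤
      3 * (s * x) + CM * (N : ℝ) ^ (-(1 / 2) : ℝ) := by
  have hx0 : 0 ≤ x := (sq_nonneg _).trans hx
  have hM := h.one_add_le_mgf hN hs0 (by linarith) hθ₁ hμ hsC
  have hM1 : 1 ≤ mgf (X N 0) (P N) s := le_trans (by nlinarith [sq_nonneg (σ * s)]) hM
  have hθmem : θ₁ ∈ Set.Icc (-θ₁) θ₁ := ⟨by linarith, le_rfl⟩
  -- The truncation level is L = x: the overshoot then costs no more than the order of sx.
  have hmain := (h.iid N hN).measureReal_staysBelow_mul_le hs0 (by linarith : s ≤ θ₁)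
    (h.integrable_exp_mul hN ⟨by linarith, by linarith⟩) (h.integrable_exp_mul hN hθmem)
    hx0 hx0 hM1 N
  have htail : N * (Real.exp (-(θ₁ - s) * x) * mgf (X N 0) (P N) θ₁) ≤
      CM * (N : ℝ) ^ (-(1 / 2) : ℝ) := by
    have h1 : N * Real.exp (-(θ₁ / 2 * x)) ≤ (N : ℝ) ^ (-(1 / 2) : ℝ) := by
      refine nat_mul_exp_neg_le_rpow hN hx (by positivity) ?_
      rw [div_le_iff₀ hθ₁] at hlog
      linarith
    have h2 : Real.exp (-(θ₁ - s) * x) ≤ Real.exp (-(θ₁ / 2 * x)) :=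
      Real.exp_le_exp.2 (by nlinarith)
    calc N * (Real.exp (-(θ₁ - s) * x) * mgf (X N 0) (P N) θ₁)
        ≤ N * (Real.exp (-(θ₁ / 2 * x)) * CM) :=
          mul_le_mul_of_nonneg_left (mul_le_mul h2 (h.mgf_le hN hθmem) mgf_nonneg
            (Real.exp_pos _).le) (Nat.cast_nonneg N)
      _ = CM * (N * Real.exp (-(θ₁ / 2 * x))) := by ring
      _ ≤ CM * (N : ℝ) ^ (-(1 / 2) : ℝ) := mul_le_mul_of_nonneg_left h1 hCM
  have hexp := exp_sub_exp_neg_le (y := s * x) (by positivity) hsx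
  have hgain := mul_le_mul_of_nonneg_left (le_one_sub_inv_pow hσ hM hsN)
    (measureReal_nonneg : 0 ≤ (P N).real (staysBelow (X N) x N))
  linarith

end SmallDriftArray

/-! ### Choice of constants and conclusion. -/

theorem theorem2p2 (θ₁ σ cμ CM : ℝ) (hθ₁ : 0 < θ₁) (hσ : 0 < σ) (hcμ : 0 < cμ) (hCM : 0 < CM) :
    ∃ (C : ℝ) (N₀ : ℕ), 1 ≤ N₀ ∧
      ∀ (Ω : ℕ → Type*) [∀ N, MeasurableSpace (Ω N)] (P : ∀ N, Measure (Ω N))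
        [∀ N, IsProbabilityMeasure (P N)] (X : ∀ N, ℕ → Ω N → ℝ),
        SmallDriftArray θ₁ σ cμ CM P X →
        ∀ N : ℕ, N₀ ≤ N → ∀ x : ℝ, (Real.log N) ^ 2 ≤ x →
          (P N).real {ω | runningMax (X N) N ω ≤ x} ≤
            C * x * Real.log N *
              max |∫ ω, X N 0 ω ∂(P N)| ((N : ℝ) ^ (-(1 / 2) : ℝ)) := by
  -- With s = Kδ, σ² s = 8δ: just enough to dominate the drift and to give N (σ² s)² ≥ 64.
  set K : ℝ := 8 / σ ^ 2 with hK
  have hK0 : 0 < K := by positivity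
  have hKσ : σ ^ 2 * K = 8 := by rw [hK]; field_simp
  set B : ℝ := (σ ^ 2 + 16) / 16 * (3 * K + CM) with hB
  -- B is the constant of the final bound; the other summands force sx ≤ 1, s ≤ θ₁ / 2 and 4 CM s ≤
  -- 3σ² whenever the claimed bound is below 1.
  refine ⟨B + K + 2 * K / θ₁ + 4 * CM * K / (3 * σ ^ 2), max 3 ⌈Real.exp (3 / θ₁)⌉₊,
    le_trans (by norm_num) (le_max_left _ _), ?_⟩
  intro Ω _ P _ X h N hN x hx
  set C : ℝ := B + K + 2 * K / θ₁ + 4 * CM * K / (3 * σ ^ 2) with hC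
  set δ : ℝ := max |∫ ω, X N 0 ω ∂(P N)| ((N : ℝ) ^ (-(1 / 2) : ℝ)) with hδ
  have hN3 : 3 ≤ N := (le_max_left _ _).trans hN
  have hN1 : 1 ≤ N := by omega
  have hNpos : (0 : ℝ) < N := by exact_mod_cast hN1
  have hlog1 : 1 ≤ Real.log N := by
    rw [Real.le_log_iff_exp_le hNpos]
    have : (3 : ℝ) ≤ N := by exact_mod_cast hN3
    linarith [Real.exp_one_lt_d9]
  have hlogθ : 3 / θ₁ ≤ Real.log N := by
    rw [Real.le_log_iff_exp_le hNpos]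
    exact Nat.ceil_le.1 ((le_max_right _ _).trans hN)
  have hx1 : 1 ≤ x := (one_le_pow₀ hlog1).trans hx
  have hNδ : (N : ℝ) ^ (-(1 / 2) : ℝ) ≤ δ := le_max_right _ _
  have hδ0 : 0 < δ := (Real.rpow_pos_of_pos hNpos _).trans_le hNδ
  have hB0 : 0 < B := by positivity
  have hC0 : 0 < C := by positivity
  rcases le_total 1 (C * x * Real.log N * δ) with hbig | hsmall
  · exact measureReal_le_one.trans hbig
  have hCxδ : C * (x * δ) ≤ 1 := by
    refine le_trans ?_ hsmall
    have : C * (x * δ) * 1 ≤ C * (x * δ) * Real.log N :=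
      mul_le_mul_of_nonneg_left hlog1 (by positivity)
    linarith
  have hδx : δ ≤ x * δ := le_mul_of_one_le_left hδ0.le hx1
  have hsmall_of_le : ∀ a : ℝ, a ≤ C → a * (x * δ) ≤ 1 := fun a ha =>
    (mul_le_mul_of_nonneg_right ha (by positivity)).trans hCxδ
  have hA1 : 0 < 2 * K / θ₁ := by positivity
  have hA2 : 0 < 4 * CM * K / (3 * σ ^ 2) := by positivity
  set s : ℝ := K * δ with hs
  have hs0 : 0 ≤ s := by positivity
  have hsx : s * x ≤ 1 := by
    have := hsmall_of_le K (by linarith)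
    rw [hs]
    linarith
  have hsθ : s ≤ θ₁ / 2 := by
    have h1 := (mul_le_mul_of_nonneg_left hδx hA1.le).trans
      (hsmall_of_le (2 * K / θ₁) (by linarith))
    rw [div_mul_eq_mul_div, div_le_one hθ₁] at h1
    rw [hs]
    linarith
  have hsC : 4 * CM * s ≤ 3 * σ ^ 2 := by
    have h1 := (mul_le_mul_of_nonneg_left hδx hA2.le).trans
      (hsmall_of_le (4 * CM * K / (3 * σ ^ 2)) (by linarith))
    rw [div_mul_eq_mul_div, div_le_one (by positivity)] at h1
    rw [hs]
    linarith
  have hσs : σ ^ 2 * s = 8 * δ := by rw [hs, ← mul_assoc, hKσ]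
  have hσδ : 64 ≤ N * (σ ^ 2 * s) ^ 2 := by
    have h1 : (1 : ℝ) = N * ((N : ℝ) ^ (-(1 / 2) : ℝ)) ^ 2 := by
      rw [← Real.rpow_natCast, ← Real.rpow_mul hNpos.le]
      norm_num [Real.rpow_neg_one, hNpos.ne']
    have h2 : N * ((N : ℝ) ^ (-(1 / 2) : ℝ)) ^ 2 ≤ N * δ ^ 2 := by gcongr
    rw [hσs]
    linarith
  have hmain := h.measureReal_staysBelow_mul_le hθ₁ hσ hCM.le hN1 hs0 hsθ
    (by rw [hσs]; linarith [le_max_left |∫ ω, X N 0 ω ∂(P N)| ((N : ℝ) ^ (-(1 / 2) : ℝ))])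
    hsC hσδ hlogθ hx hsx
  set p := (P N).real (staysBelow (X N) x N)
  have hp : p * (16 / (σ ^ 2 + 16)) ≤ (3 * K + CM) * (x * δ) := by
    have h1 : 3 * (s * x) = 3 * K * (x * δ) := by rw [hs]; ring
    have h2 := mul_le_mul_of_nonneg_left (hNδ.trans hδx) hCM.le
    linarith
  have hpB : p ≤ B * (x * δ) := by
    rw [← le_div_iff₀ (by positivity)] at hp
    refine hp.trans_eq ?_
    rw [hB, div_div_eq_mul_div]
    ring
  calc (P N).real {ω | runningMax (X N) N ω ≤ x} ≤ p :=
        measureReal_mono (setOf_runningMax_le_subset (X N) (zero_le_one.trans hx1) hN1)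
    _ ≤ B * (x * δ) := hpB
    _ ≤ C * (x * δ) := by
        gcongr
        linarith
    -- The factor log N is slack here.
    _ ≤ C * (x * δ) * Real.log N := le_mul_of_one_le_right (by positivity) hlog1
    _ = C * x * Real.log N * δ := by ring
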